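/- Let $\eta$ be Dedekind's eta function, let $p_1,p_2$ be primes (possibly equal), $N=p_1p_2$, $\zeta_{24}=e^{2\pi i/24}$ and $\phi=\zeta_{24}^{(p_1-1)(p_2-1)}$. Let $S=\begin{pmatrix}0&-1\\1&0\end{pmatrix}$, so that $(f\circ S)(z)=f(-1/z)$ for $f$ on the upper half-plane. Define $$A_\nu(z)=\frac{\eta\left(\frac{z+\nu}{p_1}\right)\eta\left(\frac{z+\nu}{p_2}\right)}{\eta(z+\nu)\,\eta\left(\frac{z+\nu}{p_1p_2}\right)}\ (\nu\in\mathbb Z),\qquad B(z)=\frac{\eta(p_1z)\,\eta(p_2z)}{\eta(z)\,\eta(p_1p_2z)}.$$ When $p_1\ne p_2$ and $u,v$ are integers with $up_1+vp_2=1$, define for $0\le\nu<p_2$ $$C_{2,\nu}(z)=\phi^{\theta_2(\nu)}\,\varepsilon_2\,\frac{\eta(p_1(z+\nu))\,\eta\left(\frac{z+\nu}{p_2}\right)}{\eta(z+\nu)\,\eta\left(\frac{p_1(z+\nu)}{p_2}\right)},\qquad \varepsilon_2=\begin{cases}\left(\frac{p_1}{p_2}\right)&p_2\ne2\\1&p_2=2,\end{cases}$$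 where, for $\nu>0$, $\mu\in\{1,\dots,p_2-1\}$ with $\mu\equiv-(\nu p_1)^{-1}\bmod p_2$ and $v_2=(1+p_1\mu\nu)/p_2$, $$\theta_2(\nu)=\begin{cases}\mu((p_2+1)v_2+1)+\nu&p_2\neq2\\(3p_1+2)\frac{\nu+1}2&p_2=2,\end{cases}\qquad \theta_2(0)=\begin{cases}uv(p_2+1)+u-1&p_2\ne2\\\frac{(3u+2)(u-1)}2&p_2=2.\end{cases}$$ The functions $C_{1,\nu}$ $(0\le\nu<p_1)$ and the exponents $\theta_1(\nu)$ are obtained from $C_{2,\nu}$, $\theta_2(\nu)$ by exchanging $(p_1,u)$ and $(p_2,v)$. Then: (i) $A_0\circ S=B$ and $B\circ S=A_0$. (ii) Suppose that $p_1$ is odd or $p_1=p_2$. If $0<\nu<p_1p_2$, $\gcd(\nu,p_1p_2)=1$ and $\omega,v_{12}$ are integers with $1=-\omega\nu+v_{12}p_1p_2$, then $A_\nu\circ S=\phi^{\theta_3(\nu)}A_\omega$, where $$\theta_3(\nu)=\begin{cases}-\omega\nu^2-2\nu+\omega+3+\nu v_{12}&p_2\ne2\\ \omega+\nu(v_{12}(1-2p_1)+2)&p_2=2.\end{cases}$$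 Suppose from now on that $p_1\neq p_2$, and let $u,v$ be any integers with $up_1+vp_2=1$. (iii) If $0<\nu=p_1\rho<p_1p_2$ and $1=-\varpi\nu+wp_2$ with integers $w$ and $0<\varpi<p_2$, then $A_\nu\circ S=\phi^{\theta_4(\rho)}C_{2,\varpi}$, where $$\theta_4(\rho)=\begin{cases}-\theta_2(\varpi)+\rho(w(p_2+1)+1)+\varpi&p_2\ne2\\-\theta_2(\varpi)+3\frac{p_1+1}2\rho^2+\rho(3w-2)+\varpi&p_2=2.\end{cases}$$ (iv) If $0<\nu<p_2$ and $0<\mu<p_2$ with $\mu\equiv-1/(\nu p_1)\bmod p_2$, then $C_{2,\nu}\circ S=A_{\mu p_1}$. (v) $C_{2,0}\circ S=\phi^{\theta_5}\,C_{1,0}$, where $$\theta_5=\begin{cases}-2\theta_1(0)&p_2\ne2\\-\theta_1(0)+u^2p_1\frac{p_1+1}2+\frac{1-u}2&p_2=2.\end{cases}$$ -/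

import Mathlib

open UpperHalfPlane ModularForm

namespace DoubleEta

noncomputable section

/-- The function `f ∘ M : z ↦ f (M z)` on the upper half-plane, for `M ∈ SL₂(ℤ)` acting by
Möbius transformations. -/
def comp (f : ℍ → ℂ) (M : Matrix.SpecialLinearGroup (Fin 2) ℤ) : ℍ → ℂ := fun z => f (M • z)

/-- `ζ_n = exp (2 π i / n)`. -/
def zeta (n : ℕ) : ℂ := Complex.exp (2 * Real.pi * Complex.I / n)

/-- `φ = ζ_24 ^ ((p₁ - 1) (p₂ - 1))`. -/
def phi (p₁ p₂ : ℕ) : ℂ := zeta 24 ^ (((p₁ : ℤ) - 1) * ((p₂ : ℤ) - 1))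

/-- `A_ν(z) = η((z+ν)/p₁) η((z+ν)/p₂) / (η(z+ν) η((z+ν)/(p₁ p₂)))`; for `ν = 0` this is the double
eta quotient `𝔴_{p₁,p₂}` itself. -/
def A (p₁ p₂ : ℕ) (ν : ℤ) : ℍ → ℂ := fun z =>
  (eta (((z : ℂ) + ν) / p₁) * eta (((z : ℂ) + ν) / p₂)) /
    (eta ((z : ℂ) + ν) * eta (((z : ℂ) + ν) / (p₁ * p₂)))

/-- `B(z) = η(p₁ z) η(p₂ z) / (η(z) η(p₁ p₂ z))`. -/
def B (p₁ p₂ : ℕ) : ℍ → ℂ := fun z =>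
  (eta (p₁ * (z : ℂ)) * eta (p₂ * (z : ℂ))) / (eta (z : ℂ) * eta (p₁ * p₂ * (z : ℂ)))

/-- For `ν` prime to `p₂`, the integer `μ ∈ {1, …, p₂ - 1}` with `μ ≡ -(ν p₁)⁻¹ mod p₂`. -/
def muOf (p₁ p₂ : ℕ) (ν : ℤ) : ℤ := ((-((ν : ZMod p₂) * (p₁ : ZMod p₂))⁻¹).val : ℤ)

/-- The exponent `θ₂(ν)`, `0 ≤ ν < p₂`, attached to `u`, `v` with `u p₁ + v p₂ = 1`. For `ν > 0` it
involves `μ ≡ -(ν p₁)⁻¹ mod p₂` and `v₂ = (1 + p₁ μ ν) / p₂`. All the integer divisions are exact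
for these arguments. -/
def theta₂ (p₁ p₂ : ℕ) (u v ν : ℤ) : ℤ :=
  if ν = 0 then
    if p₂ ≠ 2 then u * v * (p₂ + 1) + u - 1
    else (3 * u + 2) * (u - 1) / 2
  else
    if p₂ ≠ 2 then
      muOf p₁ p₂ ν * ((p₂ + 1) * ((1 + p₁ * muOf p₁ p₂ ν * ν) / p₂) + 1) + ν
    else (3 * p₁ + 2) * ((ν + 1) / 2)

/-- The exponent `θ₁`, obtained from `θ₂` by exchanging `(p₁, u)` and `(p₂, v)`. -/
def theta₁ (p₁ p₂ : ℕ) (u v ν : ℤ) : ℤ := theta₂ p₂ p₁ v u ν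

/-- `ε₂` is the Legendre symbol `(p₁ / p₂)` if `p₂ ≠ 2`, and `1` if `p₂ = 2`. -/
def eps₂ (p₁ p₂ : ℕ) [Fact p₂.Prime] : ℤ := if p₂ ≠ 2 then legendreSym p₂ p₁ else 1

/-- `C_{2,ν}(z) = φ^{θ₂(ν)} ε₂ η(p₁(z+ν)) η((z+ν)/p₂) / (η(z+ν) η(p₁(z+ν)/p₂))`. -/
def C₂ (p₁ p₂ : ℕ) [Fact p₂.Prime] (u v ν : ℤ) : ℍ → ℂ := fun z =>
  phi p₁ p₂ ^ theta₂ p₁ p₂ u v ν * (eps₂ p₁ p₂ : ℂ) *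
    ((eta (p₁ * ((z : ℂ) + ν)) * eta (((z : ℂ) + ν) / p₂)) /
      (eta ((z : ℂ) + ν) * eta (p₁ * ((z : ℂ) + ν) / p₂)))

/-- `C_{1,ν}`, obtained from `C_{2,ν}` by exchanging `(p₁, u)` and `(p₂, v)`. -/
def C₁ (p₁ p₂ : ℕ) [Fact p₁.Prime] (u v ν : ℤ) : ℍ → ℂ := C₂ p₂ p₁ v u ν

/-- The exponent `θ₃(ν)`, where `1 = -ω ν + v₁₂ p₁ p₂`. -/
def theta₃ (p₁ p₂ : ℕ) (ν ω v₁₂ : ℤ) : ℤ :=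
  if p₂ ≠ 2 then -ω * ν ^ 2 - 2 * ν + ω + 3 + ν * v₁₂
  else ω + ν * (v₁₂ * (1 - 2 * p₁) + 2)

/-- The exponent `θ₄(ρ)`, where `1 = -ϖ p₁ ρ + w p₂`. The integer division is exact for odd `p₁`,
the only case in which it is used when `p₁ ≠ p₂`. -/
def theta₄ (p₁ p₂ : ℕ) (u v ρ ϖ w : ℤ) : ℤ :=
  if p₂ ≠ 2 then -theta₂ p₁ p₂ u v ϖ + ρ * (w * (p₂ + 1) + 1) + ϖ
  else -theta₂ p₁ p₂ u v ϖ + 3 * (((p₁ : ℤ) + 1) / 2) * ρ ^ 2 + ρ * (3 * w - 2) + ϖ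

/-- The exponent of `φ` in the action of `S` on `C_{2,0}`. The integer divisions are exact when
`p₂ = 2` and `u p₁ + v p₂ = 1` with `p₁` odd. -/
def theta₅ (p₁ p₂ : ℕ) (u v : ℤ) : ℤ :=
  if p₂ ≠ 2 then -2 * theta₁ p₁ p₂ u v 0
  else -theta₁ p₁ p₂ u v 0 + (u ^ 2 * p₁ * (((p₁ : ℤ) + 1) / 2) + (1 - u) / 2)

end

end DoubleEta

open DoubleEta

namespace DoubleEta

open NumberTheorySymbols

/-! ### Roots of unity -/

/-! Everything rests on an explicit multiplier of `η` under a matrix `(a, b; c, d)` of determinant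
`1` with `c > 0`. For odd `c` it is the Jacobi symbol `(d / c)` times a power of `ζ₂₄`
(`isEtaMultiplier_of_odd`). The proof is a Euclidean algorithm on `(c, d)`: translations reduce `d`
modulo `c`, inversion exchanges `c` with `|d|`, and quadratic reciprocity keeps track of the symbol.
One more inversion gives a formula for odd `d > 0` (`isEtaMultiplier_of_odd_right`), which serves
when `c` is even.

If `1 = -ω ν + v c`, the matrix `(ν, -v; c, -ω)` sends `(z + ω) / c` to `(-1/z + ν) / c`, and its
denominator there is just `z`, whatever `c` is (`IsEtaMultiplier.eta_inversion_div`). The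
square-root factors of the four `η`-values in a quotient therefore cancel, leaving a constant. By
multiplicativity its Jacobi symbols cancel for `A_ν` with `ν` prime to `p₁ p₂`, and leave `(p₁ /
p₂)` for `ν = p₁ ρ` and odd `p₂`; this is the `ε₂` of `C_{2,ϖ}`. What remains is a congruence of
exponents modulo 24, usually split into modulo 8 (odd squares are 1) and modulo 3 (finite check).

The factor `φ^{θ₂}` makes `A_{p₁ρ} ∘ S` equal to `C_{2,ϖ}` exactly, so `θ₄ = 0`, and the converse
follows because `S` acts as an involution. For `C_{2,0}` only the inversion law is needed, and
reciprocity or the value of `(2 / p)` compares the two normalizing constants. -/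

lemma zeta_ne_zero (n : ℕ) : zeta n ≠ 0 := Complex.exp_ne_zero _

lemma zeta_pow_self {n : ℕ} (hn : n ≠ 0) : zeta n ^ n = 1 := by
  rw [zeta, ← Complex.exp_nat_mul, mul_div_cancel₀ _ (by exact_mod_cast hn),
    Complex.exp_two_pi_mul_I]

lemma zeta_zpow_congr {m n : ℤ} (h : m ≡ n [ZMOD 24]) : zeta 24 ^ m = zeta 24 ^ n := by
  obtain ⟨k, hk⟩ := h.dvd
  rw [show n = m + 24 * k by linarith, zpow_add₀ (zeta_ne_zero _), zpow_mul]
  have : zeta 24 ^ (24 : ℤ) = 1 := by exact_mod_cast zeta_pow_self (n := 24) (by norm_num)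
  simp [this]

lemma zeta_pow_twelve : zeta 24 ^ (12 : ℤ) = -1 := by
  rw [zeta, ← Complex.exp_int_mul, ← Complex.exp_pi_mul_I]
  congr 1
  push_cast
  ring

lemma zeta_pow_three :
    zeta 24 ^ (3 : ℤ) = (√2 / 2 : ℝ) + (√2 / 2 : ℝ) * Complex.I := by
  calc zeta 24 ^ (3 : ℤ) = Complex.exp ((Real.pi / 4 : ℝ) * Complex.I) := by
        rw [zeta, ← Complex.exp_int_mul]
        congr 1
        push_cast
        ring
    _ = _ := by
        rw [Complex.exp_mul_I, ← Complex.ofReal_cos, ← Complex.ofReal_sin, Real.cos_pi_div_four,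
          Real.sin_pi_div_four]

lemma zeta_pow_six : zeta 24 ^ (6 : ℤ) = Complex.I := by
  calc zeta 24 ^ (6 : ℤ) = Complex.exp (Real.pi / 2 * Complex.I) := by
        rw [zeta, ← Complex.exp_int_mul]
        congr 1
        push_cast
        ring
    _ = _ := Complex.exp_pi_div_two_mul_I

lemma zeta_pow_three_sq : (zeta 24 ^ (3 : ℤ)) ^ 2 = Complex.I := by
  rw [← zeta_pow_six, ← zpow_natCast, ← zpow_mul]
  norm_num

/-- `χ₄ (n) = ζ₂₄ ^ (6 (n - 1))` for odd `n`. -/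
lemma χ₄_eq_zeta_zpow {n : ℕ} (hn : Odd n) :
    ((ZMod.χ₄ n : ℤ) : ℂ) = zeta 24 ^ (6 * ((n : ℤ) - 1)) := by
  obtain ⟨k, rfl⟩ := hn
  rw [ZMod.χ₄_eq_neg_one_pow (by omega),
    show 6 * (((2 * k + 1 : ℕ) : ℤ) - 1) = 12 * (k : ℤ) by push_cast; ring, zpow_mul,
    zeta_pow_twelve, show (2 * k + 1) / 2 = k by omega]
  simp

/-! ### The automorphy factor -/

/-- The square root of `-i w` on the upper half-plane. -/
noncomputable def autFactor (w : ℂ) : ℂ := (Complex.sqrt Complex.I)⁻¹ * Complex.sqrt w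

lemma sqrt_sq (w : ℂ) : Complex.sqrt w ^ 2 = w := by
  simp [Complex.sqrt]

lemma sqrt_re_im_pos {w : ℂ} (hw : 0 < w.im) :
    0 < (Complex.sqrt w).re ∧ 0 < (Complex.sqrt w).im := by
  have h1 : 0 ≤ (Complex.sqrt w).re := by
    rw [Complex.sqrt, Complex.cpow_inv_two_re]
    positivity
  have h2 := congrArg Complex.im (sqrt_sq w)
  rw [sq, Complex.mul_im] at h2
  have h3 : (Complex.sqrt w).re ≠ 0 := fun h ↦ by simp [h] at h2; linarith
  have h4 := h1.lt_of_ne' h3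
  exact ⟨h4, by nlinarith⟩

lemma autFactor_sq (w : ℂ) : autFactor w ^ 2 = -Complex.I * w := by
  rw [autFactor, mul_pow, inv_pow, sqrt_sq, sqrt_sq, Complex.inv_I]

/-- The square root of `w` lies in the open first quadrant, and division by `√i` rotates it by
`-π/4`. This sector bound is what decides signs when square roots are multiplied. -/
lemma abs_autFactor_im_lt_re {w : ℂ} (hw : 0 < w.im) :
    |(autFactor w).im| < (autFactor w).re := by
  obtain ⟨h1, h2⟩ := sqrt_re_im_pos hw
  obtain ⟨h3, h4⟩ := sqrt_re_im_pos (w := Complex.I) (by simp)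
  have h5 := congrArg Complex.re (sqrt_sq Complex.I)
  rw [sq, Complex.mul_re, Complex.I_re] at h5
  have h6 : (Complex.sqrt Complex.I).re = (Complex.sqrt Complex.I).im := by nlinarith
  have h7 : 0 < Complex.normSq (Complex.sqrt Complex.I) := by
    rw [Complex.normSq_apply]; positivity
  have e : autFactor w = (Complex.sqrt Complex.I)⁻¹ * Complex.sqrt w := rfl
  generalize Complex.sqrt Complex.I = t at *
  generalize Complex.sqrt w = s at *
  have e1 : (autFactor w).re = t.im / Complex.normSq t * (s.re + s.im) := by
    simp only [e, Complex.mul_re, Complex.inv_re, Complex.inv_im, ← h6]; ring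
  have e2 : (autFactor w).im = t.im / Complex.normSq t * (s.im - s.re) := by
    simp only [e, Complex.mul_im, Complex.inv_re, Complex.inv_im, ← h6]; ring
  have h8 : 0 < t.im / Complex.normSq t := by positivity
  rw [e1, e2, abs_lt]
  constructor <;> nlinarith

lemma autFactor_re_pos {w : ℂ} (hw : 0 < w.im) : 0 < (autFactor w).re :=
  (abs_nonneg _).trans_lt (abs_autFactor_im_lt_re hw)

lemma autFactor_ne_zero {w : ℂ} (hw : 0 < w.im) : autFactor w ≠ 0 := fun h ↦ by
  simpa [h] using autFactor_re_pos hw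

lemma eq_of_sq_eq_of_re_pos {x y : ℂ} (h : x ^ 2 = y ^ 2) (hx : 0 < x.re) (hy : 0 < y.re) :
    x = y := by
  rcases sq_eq_sq_iff_eq_or_eq_neg.mp h with h | h
  · exact h
  · rw [h, Complex.neg_re] at hx
    linarith

lemma re_mul_pos_of_abs_im_lt_re {x y : ℂ} (hx : |x.im| < x.re) (hy : |y.im| < y.re) :
    0 < (x * y).re := by
  rw [Complex.mul_re]
  have := mul_lt_mul'' hx hy (abs_nonneg _) (abs_nonneg _)
  rw [← abs_mul] at this
  linarith [le_abs_self (x.im * y.im)]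

/-- `√(-i w₁) √(-i w₂) = e^{π i / 4} √(-i w₁ w₂)`. -/
lemma autFactor_mul_autFactor {x y w : ℂ} (hx : 0 < x.im) (hy : 0 < y.im) (hw : 0 < w.im)
    (h : x * y = -w) : autFactor x * autFactor y = zeta 24 ^ (3 : ℤ) * autFactor w := by
  refine eq_of_sq_eq_of_re_pos ?_
    (re_mul_pos_of_abs_im_lt_re (abs_autFactor_im_lt_re hx) (abs_autFactor_im_lt_re hy)) ?_
  · rw [mul_pow, mul_pow, autFactor_sq, autFactor_sq, autFactor_sq, zeta_pow_three_sq]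
    linear_combination Complex.I ^ 2 * h
  · have := abs_lt.mp (abs_autFactor_im_lt_re hw)
    have h2 : 0 < √2 / 2 := by positivity
    rw [zeta_pow_three]
    simp
    nlinarith

/-- `√(-i w₁) √(-i w₂) = e^{-π i / 4} √(-i w)` if `w₁ w₂ = w`. -/
lemma autFactor_mul_autFactor' {x y w : ℂ} (hx : 0 < x.im) (hy : 0 < y.im) (hw : 0 < w.im)
    (h : x * y = w) : zeta 24 ^ (3 : ℤ) * (autFactor x * autFactor y) = autFactor w := by
  have h3 : zeta 24 ^ (3 : ℤ) ≠ 0 := zpow_ne_zero _ (zeta_ne_zero _)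
  rw [← eq_inv_mul_iff_mul_eq₀ h3]
  refine eq_of_sq_eq_of_re_pos ?_
    (re_mul_pos_of_abs_im_lt_re (abs_autFactor_im_lt_re hx) (abs_autFactor_im_lt_re hy)) ?_
  · rw [mul_pow, mul_pow, inv_pow, autFactor_sq, autFactor_sq, autFactor_sq, zeta_pow_three_sq,
      Complex.inv_I]
    linear_combination Complex.I ^ 2 * h
  · have := abs_lt.mp (abs_autFactor_im_lt_re hw)
    have h2 : 0 < √2 / 2 := by positivity
    have h4 : (zeta 24 ^ (3 : ℤ))⁻¹ = (√2 / 2 : ℝ) - (√2 / 2 : ℝ) * Complex.I := by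
      rw [zeta_pow_three]
      refine inv_eq_of_mul_eq_one_right ?_
      have : (√2 : ℂ) ^ 2 = 2 := by exact_mod_cast Real.sq_sqrt zero_le_two
      push_cast
      linear_combination this / 2 - (√2 : ℂ) ^ 2 / 4 * Complex.I_sq
    rw [h4]
    simp
    nlinarith

lemma autFactor_real_mul {r : ℝ} (hr : 0 < r) {w : ℂ} (hw : 0 < w.im) :
    autFactor (r * w) = √r * autFactor w := by
  have hs : 0 < √r := Real.sqrt_pos.mpr hr
  refine eq_of_sq_eq_of_re_pos ?_ (autFactor_re_pos ?_) ?_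
  · rw [mul_pow, autFactor_sq, autFactor_sq, ← Complex.ofReal_pow, Real.sq_sqrt hr.le]
    ring
  · simpa using mul_pos hr hw
  · simpa using mul_pos hs (autFactor_re_pos hw)

/-! ### Translations and inversion -/

lemma eta_add_intCast (z : ℂ) (n : ℤ) : eta (z + n) = zeta 24 ^ n * eta z := by
  have h1 : ∀ k, eta_q k (z + n) = eta_q k z := fun k ↦ by
    simp only [eta_q, Function.Periodic.qParam]
    congr 1
    rw [show 2 * (Real.pi : ℂ) * Complex.I * (z + n) / (1 : ℝ) =
      2 * Real.pi * Complex.I * z / (1 : ℝ) + n * (2 * Real.pi * Complex.I) by push_cast; ring,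
      Complex.exp_add, Complex.exp_int_mul_two_pi_mul_I, mul_one]
  simp only [eta, h1]
  rw [← mul_assoc]
  congr 1
  rw [zeta, ← Complex.exp_int_mul, Function.Periodic.qParam, Function.Periodic.qParam,
    ← Complex.exp_add]
  congr 1
  push_cast
  ring

lemma eta_neg_one_div {z : ℂ} (hz : 0 < z.im) : eta (-1 / z) = autFactor z * eta z := by
  have := eta_comp_eq_csqrt_I_inv (x := z) hz
  simpa [autFactor, mul_assoc] using this

/-! ### The transformation formula of `η` -/

/-- Splits modulus 24 into 8, handled by explicit witnesses, and 3, stated in `ZMod 3` so that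
`decide` can finish. -/
lemma zeta_zpow_modEq_of_dvd {m n : ℤ} (h8 : (8 : ℤ) ∣ n - m)
    (h3 : (m : ZMod 3) = n) : zeta 24 ^ m = zeta 24 ^ n := by
  refine zeta_zpow_congr ((Int.modEq_iff_dvd).mpr ?_)
  have : (3 : ℤ) ∣ n - m := (ZMod.intCast_eq_intCast_iff_dvd_sub _ _ 3).mp h3
  omega

lemma jacobiSym_reciprocity_zeta {m n : ℕ} (hm : Odd m) (hn : Odd n) :
    (J(m | n) : ℂ) = zeta 24 ^ (3 * ((m : ℤ) - 1) * (n - 1)) * J(n | m) := by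
  rw [jacobiSym.quadratic_reciprocity hm hn]
  obtain ⟨k, rfl⟩ := hm
  obtain ⟨l, rfl⟩ := hn
  rw [show 3 * (((2 * k + 1 : ℕ) : ℤ) - 1) * ((2 * l + 1 : ℕ) - 1) = 12 * (k * l : ℕ) by
    push_cast; ring, zpow_mul, zeta_pow_twelve, zpow_natCast,
    show (2 * k + 1) / 2 = k by omega, show (2 * l + 1) / 2 = l by omega]
  push_cast
  ring

lemma jacobiSym_neg_zeta (m : ℤ) {n : ℕ} (hn : Odd n) :
    (J(-m | n) : ℂ) = zeta 24 ^ (6 * ((n : ℤ) - 1)) * J(m | n) := by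
  rw [jacobiSym.neg _ hn, Int.cast_mul, χ₄_eq_zeta_zpow hn]

/-- `ε` is the multiplier of `η` under `z ↦ (a z + b) / (c z + d)`. -/
def IsEtaMultiplier (a b c d : ℤ) (ε : ℂ) : Prop :=
  ∀ z : ℂ, 0 < z.im →
    eta ((a * z + b) / (c * z + d)) = ε * autFactor (c * z + d) * eta z

lemma im_neg_one_div_pos {z : ℂ} (hz : 0 < z.im) : 0 < (-1 / z).im := by
  have : 0 < Complex.normSq z := Complex.normSq_pos.mpr fun h ↦ by simp [h] at hz
  rw [neg_div, one_div, Complex.neg_im, Complex.inv_im, neg_div, neg_neg]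
  positivity

lemma ne_zero_of_im_pos {z : ℂ} (hz : 0 < z.im) : z ≠ 0 := fun h ↦ by simp [h] at hz

lemma im_linear_pos {c : ℤ} (hc : 0 < c) (d : ℤ) {z : ℂ} (hz : 0 < z.im) :
    0 < ((c : ℂ) * z + d).im := by
  have : (0 : ℝ) < c := by exact_mod_cast hc
  simpa using mul_pos this hz

lemma IsEtaMultiplier.of_translate {a b c d n : ℤ} {ε : ℂ}
    (h : IsEtaMultiplier a (b + n * a) c (d + n * c) ε) :
    IsEtaMultiplier a b c d (ε * zeta 24 ^ (-n)) := by
  intro z hz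
  have h1 := h (z + (-n : ℤ)) (by simpa using hz)
  rw [eta_add_intCast] at h1
  have e1 : (c : ℂ) * (z + (-n : ℤ)) + (d + n * c : ℤ) = c * z + d := by push_cast; ring
  have e2 : (a : ℂ) * (z + (-n : ℤ)) + (b + n * a : ℤ) = a * z + b := by push_cast; ring
  rw [e1, e2] at h1
  rw [h1]
  ring

/-- Factor the map through `z ↦ -1/z`. Of the two matrices `±M S`, the one with positive lower-left
entry is chosen, hence a separate version for `d < 0`; the two branches of the square root differ by
opposite eighth roots of unity. -/
lemma IsEtaMultiplier.of_inversion {a b c d : ℤ} {ε : ℂ} (hc : 0 < c) (hd : 0 < d)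
    (h : IsEtaMultiplier b (-a) d (-c) ε) :
    IsEtaMultiplier a b c d (ε * zeta 24 ^ (3 : ℤ)) := by
  intro z hz
  have hz0 := ne_zero_of_im_pos hz
  have hw := im_neg_one_div_pos hz
  have hcd := ne_zero_of_im_pos (im_linear_pos hc d hz)
  have h1 := h (-1 / z) hw
  have e1 : ((b : ℂ) * (-1 / z) + (-a : ℤ)) / (d * (-1 / z) + (-c : ℤ)) =
      (a * z + b) / (c * z + d) := by
    have e2 : (d : ℂ) * (-1 / z) + (-c : ℤ) = -(c * z + d) / z := by
      push_cast; field_simp; ring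
    rw [e2]
    push_cast
    field_simp
    ring
  rw [e1, eta_neg_one_div hz] at h1
  rw [h1, mul_assoc ε, mul_assoc ε (zeta 24 ^ (3 : ℤ)),
    ← autFactor_mul_autFactor (im_linear_pos hd (-c) hw) hz (im_linear_pos hc d hz)]
  · ring
  · push_cast; field_simp; ring

lemma IsEtaMultiplier.of_inversion_neg {a b c d : ℤ} {ε : ℂ} (hc : 0 < c) (hd : d < 0)
    (h : IsEtaMultiplier (-b) a (-d) c ε) :
    IsEtaMultiplier a b c d (ε * zeta 24 ^ (-3 : ℤ)) := by
  intro z hz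
  have hz0 := ne_zero_of_im_pos hz
  have hw := im_neg_one_div_pos hz
  have hcd := ne_zero_of_im_pos (im_linear_pos hc d hz)
  have h1 := h (-1 / z) hw
  have e1 : (((-b : ℤ) : ℂ) * (-1 / z) + a) / ((-d : ℤ) * (-1 / z) + c) =
      (a * z + b) / (c * z + d) := by
    have e2 : ((-d : ℤ) : ℂ) * (-1 / z) + c = (c * z + d) / z := by
      push_cast; field_simp; ring
    rw [e2]
    push_cast
    field_simp
    ring
  rw [e1, eta_neg_one_div hz] at h1
  rw [h1, ← autFactor_mul_autFactor' (im_linear_pos (neg_pos.mpr hd) c hw) hz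
    (im_linear_pos hc d hz), zpow_neg]
  · linear_combination -ε * autFactor ((-d : ℤ) * (-1 / z) + c) * autFactor z * eta z *
      mul_inv_cancel₀ (zpow_ne_zero 3 (zeta_ne_zero 24))
  · push_cast; field_simp; ring

lemma isEtaMultiplier_one {a b d : ℤ} (h : a * d - b = 1) :
    IsEtaMultiplier a b 1 d (zeta 24 ^ (a + d)) := by
  intro z hz
  have hw := im_linear_pos zero_lt_one d hz
  have h0 := ne_zero_of_im_pos hw
  have e : ((a : ℂ) * z + b) / ((1 : ℤ) * z + d) = -1 / ((1 : ℤ) * z + d) + a := by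
    rw [show b = a * d - 1 by linarith, div_add' _ _ _ h0]
    push_cast
    ring
  rw [e, eta_add_intCast, eta_neg_one_div hw, Int.cast_one, one_mul, eta_add_intCast,
    zpow_add₀ (zeta_ne_zero _)]
  ring

lemma eight_dvd_sq_sub_one {n : ℤ} (hn : Odd n) : (8 : ℤ) ∣ n ^ 2 - 1 :=
  Int.eight_dvd_sq_sub_one_of_odd hn

/-- The multiplier of `η` for odd `c > 0` is `(d / c) ζ₂₄ ^ etaExp a b c d`. -/
def etaExp (a b c d : ℤ) : ℤ := (a + d) * c - b * d * (c ^ 2 - 1) - 3 * (c - 1)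

lemma zeta_etaExp_translate {a b c d : ℤ} (n : ℤ) (hc : Odd c) (h : a * d - b * c = 1) :
    zeta 24 ^ (etaExp a (b + n * a) c (d + n * c) + -n) = zeta 24 ^ etaExp a b c d := by
  obtain ⟨m, hm⟩ := eight_dvd_sq_sub_one hc
  apply zeta_zpow_modEq_of_dvd
  · refine ⟨n * c * (2 * b + n * a) * m, ?_⟩
    simp only [etaExp]
    linear_combination (n * c * (2 * b + n * a)) * hm + n * (c ^ 2 - 1) * h
  · have h' := congrArg (Int.cast : ℤ → ZMod 3) h
    simp only [etaExp]
    push_cast at h' ⊢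
    generalize (a : ZMod 3) = a at *
    generalize (b : ZMod 3) = b at *
    generalize (c : ZMod 3) = c at *
    generalize (d : ZMod 3) = d at *
    generalize (n : ZMod 3) = n at *
    revert a b c d n
    decide

/-- The term `6 (d - 1)` encodes `(-1 / d)` and `3 (d - 1) (c - 1)` encodes the reciprocity sign. -/
lemma zeta_etaExp_inversion {a b c d : ℤ} (hc : Odd c) (hd : Odd d) (h : a * d - b * c = 1) :
    zeta 24 ^ (etaExp b (-a) d (-c) + 3 + 6 * (d - 1)) =
      zeta 24 ^ (etaExp a b c d + 3 * (d - 1) * (c - 1)) := by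
  obtain ⟨k, rfl⟩ := hc
  obtain ⟨l, rfl⟩ := hd
  refine zeta_zpow_congr (Int.modEq_iff_dvd.mpr ⟨k * l, ?_⟩)
  simp only [etaExp]
  linear_combination (2 * k + 1) * (2 * l + 1) * h

lemma zeta_etaExp_inversion_neg {a b c d : ℤ} (h : a * d - b * c = 1) :
    zeta 24 ^ (etaExp (-b) a (-d) c + -3) =
      zeta 24 ^ (etaExp a b c d + 6 * (c - 1) + 3 * (-d - 1) * (c - 1)) := by
  congr 1
  simp only [etaExp]
  linear_combination -c * d * h

theorem isEtaMultiplier_of_odd {c : ℕ} (hc : Odd c) (a b d : ℤ) (h : a * d - b * c = 1) :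
    IsEtaMultiplier a b c d (J(d | c) * zeta 24 ^ etaExp a b c d) := by
  induction c using Nat.strong_induction_on generalizing a b d with
  | _ c ih =>
  have hc0 : 0 < c := hc.pos
  rcases eq_or_lt_of_le (Nat.one_le_iff_ne_zero.mpr hc0.ne') with rfl | hc1
  · have := isEtaMultiplier_one (a := a) (b := b) (d := d) (by simpa using h)
    simpa [etaExp] using this
  -- reduction to odd `d` with `0 < |d| < c`
  suffices key : ∀ b d : ℤ, a * d - b * c = 1 → Odd d → |d| < c →
      IsEtaMultiplier a b c d (J(d | c) * zeta 24 ^ etaExp a b c d) by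
    have hcz : Odd (c : ℤ) := by exact_mod_cast hc
    obtain ⟨n, hn1, hn2⟩ : ∃ n : ℤ, Odd (d + n * c) ∧ |d + n * c| < c := by
      have h1 := Int.emod_add_mul_ediv d c
      have h2 := Int.emod_nonneg d (b := c) (by omega)
      have h3 := Int.emod_lt_of_pos d (b := c) (by omega)
      -- The determinant makes `c` and `d` coprime, and `c > 1`.
      have h4 : d % c ≠ 0 := fun h0 ↦ by
        obtain ⟨k, rfl⟩ := Int.dvd_of_emod_eq_zero h0
        have : (c : ℤ) * (a * k - b) = 1 := by linarith
        have := Int.eq_one_or_neg_one_of_mul_eq_one this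
        omega
      -- Since `c` is odd, subtracting it from an even remainder gives an odd representative, still
      -- smaller than `c` in absolute value.
      rcases Int.even_or_odd (d % c) with he | ho
      · refine ⟨-(d / c) - 1, ?_, ?_⟩
        · rw [show d + (-(d / c) - 1) * c = d % c - c by linarith]
          exact he.sub_odd hcz
        · rw [show d + (-(d / c) - 1) * c = d % c - c by linarith, abs_lt]
          omega
      · refine ⟨-(d / c), ?_, ?_⟩
        · rwa [show d + -(d / c) * c = d % c by linarith]
        · rw [show d + -(d / c) * c = d % c by linarith, abs_lt]
          omega
    have := (key (b + n * a) (d + n * c) (by linear_combination h) hn1 hn2).of_translate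
    rwa [mul_assoc, ← zpow_add₀ (zeta_ne_zero _), zeta_etaExp_translate n hcz h,
      jacobiSym.mod_left, Int.add_mul_emod_self_right, ← jacobiSym.mod_left] at this
  intro b d h hd hdc
  have hcz : Odd (c : ℤ) := by exact_mod_cast hc
  rcases lt_trichotomy d 0 with hneg | rfl | hpos
  · obtain ⟨e, he⟩ := Int.eq_ofNat_of_zero_le (a := -d) (by omega)
    have he1 : Odd e := by exact_mod_cast he ▸ hd.neg
    have he2 : e < c := by rw [abs_of_neg hneg] at hdc; omega
    have := ih e he2 he1 (-b) a c (by rw [← he]; linear_combination h)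
    rw [← he] at this
    have := this.of_inversion_neg (by omega) hneg
    rw [mul_assoc, ← zpow_add₀ (zeta_ne_zero _), zeta_etaExp_inversion_neg h] at this
    convert this using 1
    rw [show d = -(e : ℤ) by omega, jacobiSym_neg_zeta _ hc, jacobiSym_reciprocity_zeta he1 hc,
      neg_neg, zpow_add₀ (zeta_ne_zero _), zpow_add₀ (zeta_ne_zero _)]
    ring
  · exact absurd hd (by simp)
  · obtain ⟨e, rfl⟩ := Int.eq_ofNat_of_zero_le hpos.le
    have he1 : Odd e := by exact_mod_cast hd
    have he2 : e < c := by rw [abs_of_pos hpos] at hdc; omega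
    have := (ih e he2 he1 b (-a) (-c) (by linear_combination h)).of_inversion (by omega) hpos
    convert this using 1
    rw [jacobiSym_neg_zeta _ he1, jacobiSym_reciprocity_zeta he1 hc]
    have := zeta_etaExp_inversion hcz hd h
    rw [zpow_add₀ (zeta_ne_zero _), zpow_add₀ (zeta_ne_zero _), zpow_add₀ (zeta_ne_zero _)] at this
    linear_combination -(J(c | e) : ℂ) * this

/-- The multiplier of `η` for `c > 0` and odd `d > 0`. -/
theorem isEtaMultiplier_of_odd_right {c d : ℕ} (hc : 0 < c) (hd : Odd d) (a b : ℤ)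
    (h : a * d - b * c = 1) :
    IsEtaMultiplier a b c d
      (J(c | d) * zeta 24 ^ ((b - c) * d - a * c * (d ^ 2 - 1) + 3 * (d : ℤ))) := by
  have := (isEtaMultiplier_of_odd hd b (-a) (-c) (by linear_combination h)).of_inversion
    (by exact_mod_cast hc) (by exact_mod_cast hd.pos)
  convert this using 1
  rw [jacobiSym_neg_zeta _ hd, mul_comm _ (J(c | d) : ℂ), mul_assoc, mul_assoc,
    mul_assoc, ← zpow_add₀ (zeta_ne_zero _), ← zpow_add₀ (zeta_ne_zero _)]
  congr 2
  simp only [etaExp]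
  ring

/-! ### Action of `S` on the eta quotients -/

lemma coe_S_smul (z : ℍ) : ((ModularGroup.S • z : ℍ) : ℂ) = -1 / (z : ℂ) := by
  rw [modular_S_smul]
  simp [neg_div, inv_neg]

lemma comp_S_comp_S (f : ℍ → ℂ) : comp (comp f ModularGroup.S) ModularGroup.S = f := by
  ext z
  simp only [comp]
  congr 1
  apply UpperHalfPlane.ext
  rw [coe_S_smul, coe_S_smul]
  field_simp [z.ne_zero]

lemma im_div_natCast_pos {c : ℕ} (hc : 0 < c) {z : ℂ} (hz : 0 < z.im) : 0 < (z / c).im := by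
  rw [Complex.div_natCast_im]
  positivity

lemma im_natCast_mul_pos {c : ℕ} (hc : 0 < c) {z : ℂ} (hz : 0 < z.im) :
    0 < ((c : ℂ) * z).im := by
  simpa using mul_pos (Nat.cast_pos.mpr hc) hz

lemma autFactor_natCast_mul {c : ℕ} (hc : 0 < c) {w : ℂ} (hw : 0 < w.im) :
    autFactor (c * w) = √(c : ℝ) * autFactor w := by
  simpa using autFactor_real_mul (r := c) (by exact_mod_cast hc) hw

lemma eta_neg_one_div_div {c : ℕ} (hc : 0 < c) {z : ℂ} (hz : 0 < z.im) :
    eta (-1 / z / c) = autFactor (c * z) * eta (c * z) := by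
  rw [← eta_neg_one_div (im_natCast_mul_pos hc hz), div_div, mul_comm z]

lemma eta_natCast_mul_neg_one_div {c : ℕ} (hc : 0 < c) {z : ℂ} (hz : 0 < z.im) :
    eta (c * (-1 / z)) = autFactor (z / c) * eta (z / c) := by
  rw [← eta_neg_one_div (im_div_natCast_pos hc hz)]
  congr 1
  have := ne_zero_of_im_pos hz
  field_simp

lemma A_zero_comp_S {p₁ p₂ : ℕ} (h₁ : 0 < p₁) (h₂ : 0 < p₂) :
    comp (A p₁ p₂ 0) ModularGroup.S = B p₁ p₂ := by
  ext z
  have hz : 0 < (z : ℂ).im := z.im_pos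
  have hR := autFactor_ne_zero hz
  simp only [comp, A, B, coe_S_smul, Int.cast_zero, add_zero]
  rw [eta_neg_one_div_div h₁ hz, eta_neg_one_div_div h₂ hz, eta_neg_one_div hz, ← Nat.cast_mul,
    eta_neg_one_div_div (Nat.mul_pos h₁ h₂) hz, Nat.cast_mul, mul_assoc (p₁ : ℂ),
    autFactor_natCast_mul h₁ (im_natCast_mul_pos h₂ hz), autFactor_natCast_mul h₁ hz,
    autFactor_natCast_mul h₂ hz]
  have s₁ : ((√(p₁ : ℝ) : ℝ) : ℂ) ≠ 0 := by
    exact_mod_cast (Real.sqrt_pos.mpr (Nat.cast_pos.mpr h₁)).ne'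
  have s₂ : ((√(p₂ : ℝ) : ℝ) : ℂ) ≠ 0 := by
    exact_mod_cast (Real.sqrt_pos.mpr (Nat.cast_pos.mpr h₂)).ne'
  have e1 := eta_ne_zero hz
  have e2 := eta_ne_zero (im_natCast_mul_pos h₁ (im_natCast_mul_pos h₂ hz))
  field_simp

lemma IsEtaMultiplier.eta_inversion_div {c : ℕ} {ν ω v : ℤ} {ε : ℂ} (hc : 0 < c)
    (hε : IsEtaMultiplier ν (-v) c (-ω) ε) (h : 1 = -ω * ν + v * c) {z : ℂ} (hz : 0 < z.im) :
    eta ((-1 / z + ν) / c) = ε * autFactor z * eta ((z + ω) / c) := by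
  have hz0 := ne_zero_of_im_pos hz
  have hc0 : (c : ℂ) ≠ 0 := by exact_mod_cast hc.ne'
  have h1 := hε ((z + ω) / c) (im_div_natCast_pos hc (by simpa using hz))
  have h' : (1 : ℂ) = -ω * ν + v * c := by exact_mod_cast h
  have e1 : ((c : ℤ) : ℂ) * ((z + ω) / c) + (-ω : ℤ) = z := by
    push_cast; field_simp; ring
  rw [e1] at h1
  rw [← h1]
  congr 1
  push_cast
  field_simp
  linear_combination -h'

lemma phi_zpow (p₁ p₂ : ℕ) (n : ℤ) :
    phi p₁ p₂ ^ n = zeta 24 ^ (((p₁ : ℤ) - 1) * (p₂ - 1) * n) := by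
  rw [phi, ← zpow_mul]

lemma phi_ne_zero (p₁ p₂ : ℕ) : phi p₁ p₂ ≠ 0 := zpow_ne_zero _ (zeta_ne_zero _)

lemma phi_comm (p₁ p₂ : ℕ) : phi p₁ p₂ = phi p₂ p₁ := by
  rw [phi, phi, mul_comm]

lemma A_comp_S {p₁ p₂ : ℕ} (h₁ : 0 < p₁) (h₂ : 0 < p₂) {ν ω v : ℤ} {ε₁ ε₂ ε₁₂ : ℂ}
    (h : 1 = -ω * ν + v * (p₁ * p₂))
    (hε₁ : IsEtaMultiplier ν (-(v * p₂)) p₁ (-ω) ε₁)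
    (hε₂ : IsEtaMultiplier ν (-(v * p₁)) p₂ (-ω) ε₂)
    (hε₁₂ : IsEtaMultiplier ν (-v) (p₁ * p₂ : ℕ) (-ω) ε₁₂) (z : ℍ) :
    comp (A p₁ p₂ ν) ModularGroup.S z =
      ε₁ * ε₂ / (ε₁₂ * zeta 24 ^ (ν - ω)) * A p₁ p₂ ω z := by
  have hz : 0 < (z : ℂ).im := z.im_pos
  have hR := autFactor_ne_zero hz
  simp only [comp, A, coe_S_smul]
  rw [hε₁.eta_inversion_div h₁ (by linear_combination h) hz,
    hε₂.eta_inversion_div h₂ (by linear_combination h) hz, eta_add_intCast, eta_neg_one_div hz,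
    ← Nat.cast_mul,
    hε₁₂.eta_inversion_div (Nat.mul_pos h₁ h₂) (by push_cast; linear_combination h) hz,
    eta_add_intCast, zpow_sub₀ (zeta_ne_zero _)]
  field_simp [zeta_ne_zero]

lemma A_add_mul (p₁ p₂ : ℕ) (h₁ : 0 < p₁) (h₂ : 0 < p₂) (ω k : ℤ) (z : ℍ) :
    A p₁ p₂ (ω + p₁ * p₂ * k) z = phi p₁ p₂ ^ (-k) * A p₁ p₂ ω z := by
  have hp₁ : (p₁ : ℂ) ≠ 0 := by exact_mod_cast h₁.ne'
  have hp₂ : (p₂ : ℂ) ≠ 0 := by exact_mod_cast h₂.ne'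
  simp only [A]
  rw [show ((z : ℂ) + (ω + p₁ * p₂ * k : ℤ)) / p₁ = (z + ω) / p₁ + (p₂ * k : ℤ) by
      push_cast; field_simp; ring,
    show ((z : ℂ) + (ω + p₁ * p₂ * k : ℤ)) / p₂ = (z + ω) / p₂ + (p₁ * k : ℤ) by
      push_cast; field_simp; ring,
    show ((z : ℂ) + (ω + p₁ * p₂ * k : ℤ)) / (p₁ * p₂) = (z + ω) / (p₁ * p₂) + k by
      push_cast; field_simp; ring,
    show ((z : ℂ) + (ω + p₁ * p₂ * k : ℤ)) = (z + ω) + (p₁ * p₂ * k : ℤ) by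
      push_cast; ring]
  simp only [eta_add_intCast]
  rw [phi_zpow, show ((p₁ : ℤ) - 1) * (p₂ - 1) * -k =
    (p₂ * k + p₁ * k) - (p₁ * p₂ * k + k) by ring, zpow_sub₀ (zeta_ne_zero _),
    zpow_add₀ (zeta_ne_zero _), zpow_add₀ (zeta_ne_zero _)]
  field_simp [zeta_ne_zero]

/-! ### `A_ν ∘ S` for `ν` prime to `p₁ p₂`. -/

lemma zeta_theta₃_of_odd {p₁ p₂ ν ω v : ℤ} (h₁ : Odd p₁) (h₂ : Odd p₂)
    (h : 1 = -ω * ν + v * (p₁ * p₂)) :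
    zeta 24 ^ (etaExp ν (-(v * p₂)) p₁ (-ω) + etaExp ν (-(v * p₁)) p₂ (-ω) -
        (etaExp ν (-v) (p₁ * p₂) (-ω) + (ν - ω))) =
      zeta 24 ^ ((p₁ - 1) * (p₂ - 1) * (-ω * ν ^ 2 - 2 * ν + ω + 3 + ν * v)) := by
  obtain ⟨m, hm⟩ := eight_dvd_sq_sub_one h₁
  obtain ⟨n, hn⟩ := eight_dvd_sq_sub_one h₂
  apply zeta_zpow_modEq_of_dvd
  · obtain ⟨k, hk⟩ := h₁
    obtain ⟨l, hl⟩ := h₂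
    have hP : (p₁ - 1) * (p₂ - 1) * (1 - p₁ * p₂) = 8 * (-k * l * (2 * k * l + k + l)) := by
      rw [hk, hl]; ring
    refine ⟨-k * l * (2 * k * l + k + l) * ν * v +
      v * ω * (p₂ * m + p₁ * n - m * p₂ ^ 2 - n), ?_⟩
    simp only [etaExp]
    linear_combination ν * v * hP - (p₁ - 1) * (p₂ - 1) * ν * h +
      v * ω * (p₂ - p₂ ^ 2) * hm + v * ω * (p₁ - 1) * hn
  · have h' := congrArg (Int.cast : ℤ → ZMod 3) h
    simp only [etaExp]
    push_cast at h' ⊢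
    generalize (p₁ : ZMod 3) = p₁ at *
    generalize (p₂ : ZMod 3) = p₂ at *
    generalize (ν : ZMod 3) = ν at *
    generalize (ω : ZMod 3) = ω at *
    generalize (v : ZMod 3) = v at *
    clear hm hn
    revert p₁ p₂ ν ω v
    decide

lemma cast_jacobiSym_mul_self {a : ℤ} {b : ℕ} (h : IsCoprime a b) :
    (J(a | b) : ℂ) * J(a | b) = 1 := by
  rw [← sq, ← Int.cast_pow, jacobiSym.sq_one (Int.isCoprime_iff_gcd_eq_one.mp h), Int.cast_one]

lemma multiplier_quotient_eq {j₁ j₂ : ℂ} (h : j₁ * j₂ ≠ 0) (a b c d : ℤ) :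
    j₁ * zeta 24 ^ a * (j₂ * zeta 24 ^ b) / (j₁ * j₂ * zeta 24 ^ c * zeta 24 ^ d) =
      zeta 24 ^ (a + b - (c + d)) := by
  have := left_ne_zero_of_mul h
  have := right_ne_zero_of_mul h
  rw [zpow_sub₀ (zeta_ne_zero _), zpow_add₀ (zeta_ne_zero _), zpow_add₀ (zeta_ne_zero _)]
  field_simp [zeta_ne_zero]

lemma A_comp_S_of_odd {p₁ p₂ : ℕ} (h₁ : Odd p₁) (h₂ : Odd p₂) {ν ω v : ℤ}
    (h : 1 = -ω * ν + v * (p₁ * p₂)) :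
    comp (A p₁ p₂ ν) ModularGroup.S = fun z ↦ phi p₁ p₂ ^ theta₃ p₁ p₂ ν ω v * A p₁ p₂ ω z := by
  ext z
  have n₁ : NeZero p₁ := ⟨h₁.pos.ne'⟩
  have n₂ : NeZero p₂ := ⟨h₂.pos.ne'⟩
  rw [A_comp_S h₁.pos h₂.pos h
    (isEtaMultiplier_of_odd h₁ _ _ _ (by linear_combination -h))
    (isEtaMultiplier_of_odd h₂ _ _ _ (by linear_combination -h))
    (isEtaMultiplier_of_odd (h₁.mul h₂) _ _ _ (by push_cast; linear_combination -h))]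
  have hcop : IsCoprime (-ω) ((p₁ * p₂ : ℕ) : ℤ) :=
    ⟨ν, v, by push_cast; linear_combination -h⟩
  have hJ := cast_jacobiSym_mul_self hcop
  rw [jacobiSym.mul_right, Int.cast_mul] at hJ ⊢
  congr 1
  have hne := left_ne_zero_of_mul_eq_one hJ
  rw [theta₃, if_pos (by rintro rfl; exact absurd h₂ (by decide)), phi_zpow,
    ← zeta_theta₃_of_odd (by exact_mod_cast h₁) (by exact_mod_cast h₂) h,
    multiplier_quotient_eq hne, Nat.cast_mul]

lemma zeta_theta₃_of_two {p ν ω v : ℤ} (hν : Odd ν) (hω : Odd ω)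
    (h : 1 = -ω * ν + v * (p * 2)) :
    zeta 24 ^ (((-(v * 2) - p) * -ω - ν * p * ((-ω) ^ 2 - 1) + 3 * -ω) +
        ((-(v * p) - 2) * -ω - ν * 2 * ((-ω) ^ 2 - 1) + 3 * -ω) -
        (((-v - p * 2) * -ω - ν * (p * 2) * ((-ω) ^ 2 - 1) + 3 * -ω) + (ν - ω))) =
      zeta 24 ^ ((p - 1) * (2 - 1) * (ω + ν * (v * (1 - 2 * p) + 2))) := by
  obtain ⟨m, hm⟩ := eight_dvd_sq_sub_one hω
  obtain ⟨n, hn⟩ := eight_dvd_sq_sub_one hν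
  apply zeta_zpow_modEq_of_dvd
  · obtain ⟨r, hr⟩ := (Int.even_mul_succ_self p)
    obtain ⟨s, hs⟩ := (Int.even_mul_pred_self v)
    -- The determinant relation times `ν`, with `ν² = 1 + 8 n`. The remaining factor 8 comes from
    -- the even numbers `p (p + 1)` and `v (v - 1)`.
    have hsum : ν + ω = 2 * v * p * ν - 8 * n * ω := by
      linear_combination ν * h - ω * hn
    refine ⟨-ν * r * s + n * ω * (1 - 2 * p + v * (1 + p)) + m * ν * (2 - p), ?_⟩
    linear_combination -(1 - 2 * p + v * (1 + p)) * hsum + ν * (2 - p) * hm -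
      ν * 2 * v * (v - 1) * hr - ν * 4 * r * hs
  · have h' := congrArg (Int.cast : ℤ → ZMod 3) h
    push_cast at h' ⊢
    generalize (p : ZMod 3) = p at *
    generalize (ν : ZMod 3) = ν at *
    generalize (ω : ZMod 3) = ω at *
    generalize (v : ZMod 3) = v at *
    clear hm hn hν hω
    revert p ν ω v
    decide

lemma zeta_theta₃_translate {p ν ω v k : ℤ} (hν : Odd ν) (h : 1 = -ω * ν + v * (p * 2)) :
    zeta 24 ^ ((p - 1) * (2 - 1) * (ω + ν * (v * (1 - 2 * p) + 2))) =
      zeta 24 ^ ((p - 1) * (2 - 1) *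
        ((ω + p * 2 * k + ν * ((v + k * ν) * (1 - 2 * p) + 2)) + -k)) := by
  obtain ⟨n, hn⟩ := eight_dvd_sq_sub_one hν
  apply zeta_zpow_modEq_of_dvd
  · refine ⟨(p - 1) * k * (1 - 2 * p) * n, ?_⟩
    linear_combination (p - 1) * k * (1 - 2 * p) * hn
  · have h' := congrArg (Int.cast : ℤ → ZMod 3) h
    push_cast at h' ⊢
    generalize (p : ZMod 3) = p at *
    generalize (ν : ZMod 3) = ν at *
    generalize (ω : ZMod 3) = ω at *
    generalize (v : ZMod 3) = v at *
    generalize (k : ZMod 3) = k at *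
    clear hn hν
    revert p ν ω v k
    decide

/-- Here `c` can be even, but `ω ν` is odd, so the formula for odd `d = -ω` applies; it needs `d >
0`. The symbols `(p / d)`, `(2 / d)` and `(2 p / d)` cancel. -/
lemma A_comp_S_of_two_of_neg {p : ℕ} (hp : 0 < p) {ν ω v : ℤ} (hω : ω < 0)
    (h : 1 = -ω * ν + v * (p * 2)) :
    comp (A p 2 ν) ModularGroup.S = fun z ↦ phi p 2 ^ theta₃ p 2 ν ω v * A p 2 ω z := by
  ext z
  have hodd : Odd (ω * ν) := ⟨v * p - 1, by linear_combination h⟩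
  obtain ⟨hωo, hνo⟩ := Int.odd_mul.mp hodd
  obtain ⟨d, hd⟩ := Int.eq_ofNat_of_zero_le (a := -ω) (by omega)
  have hdo : Odd d := by exact_mod_cast hd ▸ hωo.neg
  have e₁ := isEtaMultiplier_of_odd_right hp hdo ν (-(v * (2 : ℕ)))
    (by rw [← hd]; push_cast; linear_combination -h)
  have e₂ := isEtaMultiplier_of_odd_right two_pos hdo ν (-(v * p))
    (by rw [← hd]; push_cast; linear_combination -h)
  have e₁₂ := isEtaMultiplier_of_odd_right (Nat.mul_pos hp two_pos) hdo ν (-v)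
    (by rw [← hd]; push_cast; linear_combination -h)
  rw [← hd] at e₁ e₂ e₁₂
  rw [A_comp_S hp two_pos h e₁ e₂ e₁₂]
  have hcop : IsCoprime ((p * 2 : ℕ) : ℤ) (d : ℤ) :=
    ⟨v, ν, by rw [← hd]; push_cast; linear_combination -h⟩
  have hJ := cast_jacobiSym_mul_self hcop
  rw [Nat.cast_mul, jacobiSym.mul_left, Int.cast_mul] at hJ ⊢
  congr 1
  have hne := left_ne_zero_of_mul_eq_one hJ
  rw [multiplier_quotient_eq hne, theta₃, if_neg (by simp), phi_zpow]
  have key := zeta_theta₃_of_two hνo hωo h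
  push_cast
  exact key

lemma A_comp_S_of_two {p : ℕ} (hp : 0 < p) {ν ω v : ℤ} (h : 1 = -ω * ν + v * (p * 2)) :
    comp (A p 2 ν) ModularGroup.S = fun z ↦ phi p 2 ^ theta₃ p 2 ν ω v * A p 2 ω z := by
  have hodd : Odd (ω * ν) := ⟨v * p - 1, by linear_combination h⟩
  obtain ⟨hωo, hνo⟩ := Int.odd_mul.mp hodd
  obtain ⟨k, hk⟩ : ∃ k : ℤ, ω + p * 2 * k < 0 := by
    refine ⟨-|ω| - 1, ?_⟩
    have h1 : (1 : ℤ) ≤ p := by exact_mod_cast hp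
    nlinarith [le_abs_self ω, abs_nonneg ω]
  -- Replacing `(ω, v)` by `(ω + 2 p k, v + k ν)` preserves the determinant relation and changes
  -- `A_ω` only by a power of `φ`.
  rw [A_comp_S_of_two_of_neg hp (v := v + k * ν) hk (by linear_combination h)]
  ext z
  have := A_add_mul p 2 hp two_pos ω k z
  rw [Nat.cast_two] at this
  rw [this, ← mul_assoc, ← zpow_add₀ (phi_ne_zero _ _)]
  congr 1
  have key := zeta_theta₃_translate (k := k) hνo h
  simp only [theta₃, ne_eq, not_true_eq_false, if_false]
  rw [phi_zpow, phi_zpow, Nat.cast_two, key]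

/-! ### `A_{p₁ρ} ∘ S` and the functions `C_{2,ϖ}`. -/

lemma A_mul_comp_S {p₁ p₂ : ℕ} (h₁ : 0 < p₁) (h₂ : 0 < p₂) {ρ ϖ w : ℤ} {ε ε' : ℂ}
    (h : 1 = -ϖ * (p₁ * ρ) + w * p₂)
    (hε : IsEtaMultiplier (p₁ * ρ) (-w) p₂ (-ϖ) ε)
    (hε' : IsEtaMultiplier ρ (-w) p₂ (-(p₁ * ϖ)) ε') (z : ℍ) :
    comp (A p₁ p₂ (p₁ * ρ)) ModularGroup.S z =
      ε / ε' * zeta 24 ^ (ρ + ϖ - (p₁ * ρ + p₁ * ϖ)) *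
        ((eta (p₁ * ((z : ℂ) + ϖ)) * eta (((z : ℂ) + ϖ) / p₂)) /
          (eta ((z : ℂ) + ϖ) * eta (p₁ * ((z : ℂ) + ϖ) / p₂))) := by
  have hz : 0 < (z : ℂ).im := z.im_pos
  have hz₁ := im_natCast_mul_pos h₁ hz
  have hz0 := ne_zero_of_im_pos hz
  have hR := autFactor_ne_zero hz
  have hR₁ := autFactor_ne_zero hz₁
  have hp₁ : (p₁ : ℂ) ≠ 0 := by exact_mod_cast h₁.ne'
  have e0 := hε.eta_inversion_div h₂ h hz
  -- The second matrix is used at `p₁ z` in place of `z`, so `p₁` moves from `ρ` to `ϖ` in the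
  -- relation.
  have e1 := hε'.eta_inversion_div h₂ (by linear_combination h) hz₁
  have e2 : (-1 / (z : ℂ) + (p₁ * ρ : ℤ)) / p₁ = -1 / (p₁ * z) + ρ := by
    push_cast; field_simp
  have e3 : (-1 / (z : ℂ) + (p₁ * ρ : ℤ)) / (p₁ * p₂) = (-1 / (p₁ * z) + ρ) / p₂ := by
    rw [← div_div, e2]
  have e4 : (p₁ : ℂ) * z + (p₁ * ϖ : ℤ) = p₁ * (z + ϖ) := by push_cast; ring
  simp only [comp, A, coe_S_smul]
  rw [e2, e3, e0, e1, eta_add_intCast, eta_neg_one_div hz₁, eta_add_intCast, eta_neg_one_div hz,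
    ← e4, eta_add_intCast, eta_add_intCast, zpow_sub₀ (zeta_ne_zero _), zpow_add₀ (zeta_ne_zero _),
    zpow_add₀ (zeta_ne_zero _)]
  field_simp [zeta_ne_zero]

lemma muOf_eq {p₁ p₂ : ℕ} [Fact p₂.Prime] {ν μ : ℤ} (h0 : 0 < μ) (hμ : μ < p₂)
    (h : μ * (ν * p₁) ≡ -1 [ZMOD p₂]) : muOf p₁ p₂ ν = μ := by
  have h1 := (ZMod.intCast_eq_intCast_iff _ _ p₂).mpr h
  push_cast at h1
  have h2 : (ν : ZMod p₂) * p₁ ≠ 0 := fun h0 ↦ by simp [h0] at h1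
  have h3 : -((ν : ZMod p₂) * (p₁ : ZMod p₂))⁻¹ = (μ : ZMod p₂) := by
    rw [neg_eq_iff_eq_neg]
    exact inv_eq_of_mul_eq_one_right (by linear_combination -h1)
  rw [muOf, h3, ZMod.val_intCast, Int.emod_eq_of_lt h0.le hμ]

lemma zeta_theta₂_of_odd {p₁ p₂ ρ ϖ w : ℤ} (h₂ : Odd p₂) (h : 1 = -ϖ * (p₁ * ρ) + w * p₂) :
    zeta 24 ^ (etaExp (p₁ * ρ) (-w) p₂ (-ϖ) - etaExp ρ (-w) p₂ (-(p₁ * ϖ)) +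
        (ρ + ϖ - (p₁ * ρ + p₁ * ϖ))) =
      zeta 24 ^ ((p₁ - 1) * (p₂ - 1) * (ρ * ((p₂ + 1) * w + 1) + ϖ)) := by
  obtain ⟨n, hn⟩ := eight_dvd_sq_sub_one h₂
  apply zeta_zpow_modEq_of_dvd
  · refine ⟨(p₁ - 1) * w * (ρ - ϖ) * n, ?_⟩
    simp only [etaExp]
    linear_combination (p₁ - 1) * w * (ρ - ϖ) * hn
  · have h' := congrArg (Int.cast : ℤ → ZMod 3) h
    simp only [etaExp]
    push_cast at h' ⊢
    generalize (p₁ : ZMod 3) = p₁ at *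
    generalize (p₂ : ZMod 3) = p₂ at *
    generalize (ρ : ZMod 3) = ρ at *
    generalize (ϖ : ZMod 3) = ϖ at *
    generalize (w : ZMod 3) = w at *
    clear hn
    revert p₁ p₂ ρ ϖ w
    decide

/-- The number `ρ` is the `μ` attached to `ϖ`, and `w` is its `v₂`, so `θ₂(ϖ)` cancels the rest. For
`p₂ = 2` necessarily `ρ = ϖ = 1` and `2 w = p₁ + 1`. -/
lemma theta₄_eq_zero {p₁ p₂ : ℕ} [Fact p₂.Prime] (u v : ℤ) {ρ ϖ w : ℤ} (hρ0 : 0 < ρ)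
    (hρ : ρ < p₂) (hϖ0 : 0 < ϖ) (hϖ : ϖ < p₂) (h : 1 = -ϖ * (p₁ * ρ) + w * p₂) :
    theta₄ p₁ p₂ u v ρ ϖ w = 0 := by
  by_cases h₂ : p₂ = 2
  · subst h₂
    obtain rfl : ρ = 1 := by push_cast at hρ; omega
    obtain rfl : ϖ = 1 := by push_cast at hϖ; omega
    rw [theta₄, if_neg (by simp), theta₂, if_neg one_ne_zero, if_neg (by simp)]
    push_cast at h
    omega
  · have hmu : muOf p₁ p₂ ϖ = ρ := muOf_eq hρ0 hρ
      (Int.modEq_iff_dvd.mpr ⟨-w, by linear_combination -h⟩)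
    have hw : (1 + p₁ * ρ * ϖ) / (p₂ : ℤ) = w :=
      Int.ediv_eq_of_eq_mul_left (by exact_mod_cast (Fact.out : p₂.Prime).ne_zero)
        (by linear_combination h)
    rw [theta₄, if_pos h₂, theta₂, if_neg hϖ0.ne', if_pos h₂, hmu, hw]
    ring

/-- `(2 / (2 k + 1)) = ζ₂₄ ^ (6 k (k + 1))`. -/
lemma jacobiSym_two_zeta (k : ℕ) :
    (J(2 | 2 * k + 1) : ℂ) = zeta 24 ^ (6 * (k : ℤ) * (k + 1)) := by
  have h : ∃ j : ℕ, k = 4 * j ∨ k = 4 * j + 1 ∨ k = 4 * j + 2 ∨ k = 4 * j + 3 :=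
    ⟨k / 4, by omega⟩
  rw [jacobiSym.at_two ⟨k, rfl⟩, ZMod.χ₈_nat_eq_if_mod_eight, if_neg (by omega)]
  obtain ⟨j, rfl | rfl | rfl | rfl⟩ := h
  · rw [if_pos (by omega), Int.cast_one, ← zpow_zero (zeta 24)]
    exact zeta_zpow_congr (Int.modEq_iff_dvd.mpr ⟨j * (4 * j + 1), by push_cast; ring⟩)
  · rw [if_neg (by omega), Int.cast_neg, Int.cast_one, ← zeta_pow_twelve]
    exact zeta_zpow_congr (Int.modEq_iff_dvd.mpr ⟨j * (4 * j + 3), by push_cast; ring⟩)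
  · rw [if_neg (by omega), Int.cast_neg, Int.cast_one, ← zeta_pow_twelve]
    exact zeta_zpow_congr (Int.modEq_iff_dvd.mpr ⟨4 * j ^ 2 + 5 * j + 1, by push_cast; ring⟩)
  · rw [if_pos (by omega), Int.cast_one, ← zpow_zero (zeta 24)]
    exact zeta_zpow_congr (Int.modEq_iff_dvd.mpr ⟨(4 * j + 3) * (j + 1), by push_cast; ring⟩)

lemma odd_of_prime_ne_two {p : ℕ} [hp : Fact p.Prime] (h : p ≠ 2) : Odd p :=
  hp.out.odd_of_ne_two h

section

variable {p₁ p₂ : ℕ} [Fact p₁.Prime] [Fact p₂.Prime]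

lemma A_mul_comp_S_of_odd (h₂ : p₂ ≠ 2) (u v : ℤ) {ρ ϖ w : ℤ} (hρ0 : 0 < ρ)
    (hρ : ρ < p₂) (hϖ0 : 0 < ϖ) (h : 1 = -ϖ * (p₁ * ρ) + w * p₂) :
    comp (A p₁ p₂ (p₁ * ρ)) ModularGroup.S = C₂ p₁ p₂ u v ϖ := by
  have hp₁ : 0 < p₁ := (Fact.out : p₁.Prime).pos
  have hp₂ : 0 < p₂ := (Fact.out : p₂.Prime).pos
  have hodd := odd_of_prime_ne_two h₂
  ext z
  rw [A_mul_comp_S hp₁ hp₂ h (isEtaMultiplier_of_odd hodd _ _ _ (by linear_combination -h))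
    (isEtaMultiplier_of_odd hodd _ _ _ (by linear_combination -h)), C₂]
  congr 1
  have hmu : muOf p₁ p₂ ϖ = ρ := muOf_eq hρ0 hρ
    (Int.modEq_iff_dvd.mpr ⟨-w, by linear_combination -h⟩)
  have hw : (1 + p₁ * ρ * ϖ) / (p₂ : ℤ) = w :=
    Int.ediv_eq_of_eq_mul_left (by exact_mod_cast hp₂.ne') (by linear_combination h)
  have hcop : IsCoprime (-ϖ) (p₂ : ℤ) := ⟨p₁ * ρ, w, by linear_combination -h⟩
  have hcop' : IsCoprime (p₁ : ℤ) (p₂ : ℤ) := ⟨-ϖ * ρ, w, by linear_combination -h⟩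
  have hJ := left_ne_zero_of_mul_eq_one (cast_jacobiSym_mul_self hcop)
  have hJ' := cast_jacobiSym_mul_self hcop'
  have hJ'0 := left_ne_zero_of_mul_eq_one hJ'
  have key := zeta_theta₂_of_odd (p₁ := p₁) (by exact_mod_cast hodd) h
  rw [zpow_add₀ (zeta_ne_zero _), zpow_sub₀ (zeta_ne_zero _)] at key
  rw [theta₂, if_neg hϖ0.ne', if_pos h₂, hmu, hw, phi_zpow, ← key, eps₂, if_pos h₂,
    jacobiSym.legendreSym.to_jacobiSym, ← mul_neg, jacobiSym.mul_left, Int.cast_mul]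
  field_simp [zeta_ne_zero]
  -- The quotient of multipliers contains the inverse of `(p₁ / p₂)`, which is the symbol itself.
  linear_combination -hJ'

/-- The multiplier of `η` for `c = 2`. -/
lemma isEtaMultiplier_two {a b n : ℤ} (h : a * (1 - n * 2) - b * 2 = 1) :
    IsEtaMultiplier a b 2 (1 - n * 2) (zeta 24 ^ (b + n * a + 1 - n)) := by
  -- Translating to `d = 1` makes the symbol trivial and also covers negative `d`.
  have := isEtaMultiplier_of_odd_right two_pos odd_one a (b + n * a)
    (by push_cast; linear_combination h)
  have h2 := IsEtaMultiplier.of_translate (a := a) (b := b) (c := 2) (d := 1 - n * 2) (n := n)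
    (by simpa using this)
  convert h2 using 1
  rw [← zpow_add₀ (zeta_ne_zero _)]
  congr 1
  ring

lemma A_mul_comp_S_of_two (u v : ℤ) {w : ℤ} (h : 1 = -1 * (p₁ * 1) + w * (2 : ℕ)) :
    comp (A p₁ 2 (p₁ * 1)) ModularGroup.S = C₂ p₁ 2 u v 1 := by
  have hp₁ : 0 < p₁ := (Fact.out : p₁.Prime).pos
  ext z
  have e : IsEtaMultiplier (p₁ * 1) (-w) (2 : ℕ) (-1) (zeta 24 ^ (-w + 1 * (p₁ * 1) + 1 - 1)) :=
    isEtaMultiplier_two (n := 1) (by push_cast at h; linear_combination -h)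
  have e' : IsEtaMultiplier 1 (-w) (2 : ℕ) (-(p₁ * 1)) (zeta 24 ^ (-w + w * 1 + 1 - w)) := by
    have := isEtaMultiplier_two (a := 1) (b := -w) (n := w)
      (by ring)
    rwa [show 1 - w * 2 = -((p₁ : ℤ) * 1) by push_cast at h; linarith] at this
  rw [A_mul_comp_S hp₁ two_pos h e e', C₂]
  congr 1
  rw [theta₂, if_neg one_ne_zero, if_neg (by simp), eps₂, if_neg (by simp), phi_zpow,
    Int.cast_one, mul_one (zeta 24 ^ _), ← zpow_sub₀ (zeta_ne_zero _), ← zpow_add₀ (zeta_ne_zero _)]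
  obtain hp : (p₁ : ℤ) = 2 * w - 1 := by push_cast at h; linarith
  apply zeta_zpow_congr
  obtain ⟨r, hr⟩ := Int.even_mul_pred_self w
  rw [hp, Int.modEq_iff_dvd, show ((1 : ℤ) + 1) / 2 = 1 by norm_num]
  refine ⟨r, ?_⟩
  push_cast
  linear_combination 12 * hr

lemma A_mul_comp_S_eq_C₂ (u v : ℤ) {ρ ϖ w : ℤ} (hρ0 : 0 < ρ)
    (hρ : ρ < p₂) (hϖ0 : 0 < ϖ) (hϖ : ϖ < p₂) (h : 1 = -ϖ * (p₁ * ρ) + w * p₂) :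
    comp (A p₁ p₂ (p₁ * ρ)) ModularGroup.S = C₂ p₁ p₂ u v ϖ := by
  by_cases h₂ : p₂ = 2
  · subst h₂
    obtain rfl : ρ = 1 := by push_cast at hρ; omega
    obtain rfl : ϖ = 1 := by push_cast at hϖ; omega
    exact A_mul_comp_S_of_two u v h
  · exact A_mul_comp_S_of_odd h₂ u v hρ0 hρ hϖ0 h

/-! ### `C_{2,0} ∘ S` and the comparison of normalizing constants. -/

lemma C₂_zero_comp_S (u v : ℤ) (z : ℍ) :
    comp (C₂ p₁ p₂ u v 0) ModularGroup.S z =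
      phi p₁ p₂ ^ theta₂ p₁ p₂ u v 0 * eps₂ p₁ p₂ *
        ((eta (p₂ * (z : ℂ)) * eta ((z : ℂ) / p₁)) /
          (eta (z : ℂ) * eta (p₂ * (z : ℂ) / p₁))) := by
  have h₁ : 0 < p₁ := (Fact.out : p₁.Prime).pos
  have h₂ : 0 < p₂ := (Fact.out : p₂.Prime).pos
  have hz : 0 < (z : ℂ).im := z.im_pos
  have hz₁ := im_div_natCast_pos h₁ hz
  have hR := autFactor_ne_zero hz
  have hR₁ := autFactor_ne_zero hz₁
  have s₂ : ((√(p₂ : ℝ) : ℝ) : ℂ) ≠ 0 := by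
    exact_mod_cast (Real.sqrt_pos.mpr (Nat.cast_pos.mpr h₂)).ne'
  simp only [comp, C₂, coe_S_smul, Int.cast_zero, add_zero]
  have e : (p₁ : ℂ) * (-1 / z) / p₂ = -1 / (p₂ * (z / p₁)) := by
    have := z.ne_zero
    field_simp
  have hη := eta_ne_zero hz
  have hη' := eta_ne_zero (im_natCast_mul_pos h₂ hz₁)
  rw [e, eta_natCast_mul_neg_one_div h₁ hz, eta_neg_one_div_div h₂ hz, eta_neg_one_div hz,
    eta_neg_one_div (im_natCast_mul_pos h₂ hz₁), autFactor_natCast_mul h₂ hz,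
    autFactor_natCast_mul h₂ hz₁, mul_div_assoc (p₂ : ℂ)]
  field_simp

lemma zeta_theta₅_odd_odd {p₁ p₂ u v : ℤ} (h₁ : Odd p₁) (h₂ : Odd p₂) (h : u * p₁ + v * p₂ = 1) :
    zeta 24 ^ ((p₁ - 1) * (p₂ - 1) * (u * v * (p₂ + 1) + u - 1) + 3 * (p₁ - 1) * (p₂ - 1)) =
      zeta 24 ^ ((p₁ - 1) * (p₂ - 1) * -(v * u * (p₁ + 1) + v - 1)) := by
  apply zeta_zpow_modEq_of_dvd
  · obtain ⟨k, rfl⟩ := h₁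
    obtain ⟨l, rfl⟩ := h₂
    refine ⟨-k * l * (u * v * (k + l + 2) + 1 - u * k - v * l), ?_⟩
    linear_combination -4 * k * l * h
  · have h' := congrArg (Int.cast : ℤ → ZMod 3) h
    push_cast at h' ⊢
    generalize (p₁ : ZMod 3) = p₁ at *
    generalize (p₂ : ZMod 3) = p₂ at *
    generalize (u : ZMod 3) = u at *
    generalize (v : ZMod 3) = v at *
    clear h₁ h₂
    revert p₁ p₂ u v
    decide

/-- Half of the exponent congruence modulo 24 for `p₂ = 2`, `p₁ = 2 k + 1`, `u = 2 t + 1`; the term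
`3 k (k + 1)` is half the exponent of `(2 / p₁)`. -/
lemma twelve_dvd_theta₅_two_right (k t : ℤ) :
    (12 : ℤ) ∣ k * ((2 * t + 1) ^ 2 * (2 * k + 1) * (k + 1) - t) + 3 * k * (k + 1) -
      k * ((6 * t + 5) * t) := by
  refine (ZMod.intCast_zmod_eq_zero_iff_dvd _ 12).mp ?_
  push_cast
  generalize (k : ZMod 12) = k
  generalize (t : ZMod 12) = t
  revert k t
  decide

/-- The analogue for `p₁ = 2`, `p₂ = 2 l + 1`, `v = 2 t + 1`, which force `u = -(2 t l + t + l)`. -/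
lemma twelve_dvd_theta₅_two_left (l t : ℤ) :
    (12 : ℤ) ∣ l * (-(2 * t * l + t + l) * (2 * t + 1) * (2 * l + 2) - (2 * t * l + t + l) - 1 +
      (6 * t + 5) * t) + 3 * l * (l + 1) := by
  refine (ZMod.intCast_zmod_eq_zero_iff_dvd _ 12).mp ?_
  push_cast
  generalize (l : ZMod 12) = l
  generalize (t : ZMod 12) = t
  revert l t
  decide

lemma phi_theta₅ (hne : p₁ ≠ p₂) {u v : ℤ} (h : u * p₁ + v * p₂ = 1) :
    phi p₁ p₂ ^ theta₂ p₁ p₂ u v 0 * (eps₂ p₁ p₂ : ℂ) =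
      phi p₁ p₂ ^ theta₅ p₁ p₂ u v *
        (phi p₂ p₁ ^ theta₂ p₂ p₁ v u 0 * (eps₂ p₂ p₁ : ℂ)) := by
  rw [phi_comm p₂ p₁, ← mul_assoc, ← zpow_add₀ (phi_ne_zero _ _), phi_zpow, phi_zpow]
  by_cases h₂ : p₂ = 2
  · subst h₂
    obtain ⟨k, rfl⟩ := odd_of_prime_ne_two hne
    have hu : Odd u := by
      have : Odd (u * (2 * k + 1 : ℕ)) := ⟨-v, by push_cast at h ⊢; linear_combination h⟩
      exact (Int.odd_mul.mp this).1
    obtain ⟨t, rfl⟩ := hu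
    rw [theta₅, if_neg (by simp), theta₁, theta₂, if_pos rfl, if_neg (by simp), eps₂,
      if_neg (by simp), eps₂, if_pos hne, jacobiSym.legendreSym.to_jacobiSym, Nat.cast_two,
      jacobiSym_two_zeta, Int.cast_one, mul_one, ← zpow_add₀ (zeta_ne_zero _)]
    rw [show (3 * (2 * t + 1) + 2) * (2 * t + 1 - 1) / 2 = (6 * t + 5) * t by
        rw [show (3 * (2 * t + 1) + 2) * (2 * t + 1 - 1) = (6 * t + 5) * t * 2 by ring]
        exact Int.mul_ediv_cancel _ two_ne_zero,
      show (1 - (2 * t + 1)) / 2 = -t by omega,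
      show (((2 * k + 1 : ℕ) : ℤ) + 1) / 2 = k + 1 by push_cast; omega]
    obtain ⟨m, hm⟩ := twelve_dvd_theta₅_two_right k t
    refine zeta_zpow_congr (Int.modEq_iff_dvd.mpr ⟨m, ?_⟩)
    push_cast
    linear_combination 2 * hm
  obtain ⟨l, rfl⟩ := odd_of_prime_ne_two h₂
  rw [theta₅, if_pos h₂, theta₁]
  by_cases h₁ : p₁ = 2
  · subst h₁
    have hv : Odd v := by
      have : Odd (v * (2 * l + 1 : ℕ)) := ⟨-u, by push_cast at h ⊢; linear_combination h⟩
      exact (Int.odd_mul.mp this).1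
    obtain ⟨t, rfl⟩ := hv
    obtain rfl : u = -(2 * t * l + t + l) := by push_cast at h; linarith
    rw [theta₂, if_pos rfl, if_pos h₂, theta₂, if_pos rfl, if_neg (by simp), eps₂, if_pos h₂,
      jacobiSym.legendreSym.to_jacobiSym, Nat.cast_two, jacobiSym_two_zeta, eps₂, if_neg (by simp),
      Int.cast_one, mul_one, ← zpow_add₀ (zeta_ne_zero _)]
    rw [show (3 * (2 * t + 1) + 2) * (2 * t + 1 - 1) / 2 = (6 * t + 5) * t by
        rw [show (3 * (2 * t + 1) + 2) * (2 * t + 1 - 1) = (6 * t + 5) * t * 2 by ring]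
        exact Int.mul_ediv_cancel _ two_ne_zero]
    obtain ⟨m, hm⟩ := twelve_dvd_theta₅_two_left l t
    refine zeta_zpow_congr (Int.modEq_iff_dvd.mpr ⟨-m, ?_⟩)
    push_cast
    linear_combination -2 * hm
  · have ho₁ := odd_of_prime_ne_two h₁
    have ho₂ := odd_of_prime_ne_two h₂
    have key := zeta_theta₅_odd_odd (by exact_mod_cast ho₁) (by exact_mod_cast ho₂) h
    rw [theta₂, if_pos rfl, if_pos h₂, theta₂, if_pos rfl, if_pos h₁, eps₂, if_pos h₂, eps₂,
      if_pos h₁, jacobiSym.legendreSym.to_jacobiSym, jacobiSym.legendreSym.to_jacobiSym,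
      jacobiSym_reciprocity_zeta ho₁ ho₂, ← mul_assoc, ← zpow_add₀ (zeta_ne_zero _), key]
    congr 2
    ring

lemma C₂_zero_comp_S_eq_C₁ (hne : p₁ ≠ p₂) {u v : ℤ} (h : u * p₁ + v * p₂ = 1) :
    comp (C₂ p₁ p₂ u v 0) ModularGroup.S =
      fun z ↦ phi p₁ p₂ ^ theta₅ p₁ p₂ u v * C₁ p₁ p₂ u v 0 z := by
  ext z
  rw [C₂_zero_comp_S, phi_theta₅ hne h, C₁, C₂, Int.cast_zero, add_zero, mul_assoc]

lemma C₂_comp_S_eq_A (u v : ℤ) {ν μ : ℤ} (hν0 : 0 < ν) (hν : ν < p₂) (hμ0 : 0 < μ) (hμ : μ < p₂)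
    (h : μ * (ν * p₁) ≡ -1 [ZMOD p₂]) :
    comp (C₂ p₁ p₂ u v ν) ModularGroup.S = A p₁ p₂ (μ * p₁) := by
  obtain ⟨w, hw⟩ := h.dvd
  -- The relation is symmetric in `μ` and `ν`, so `C_{2,ν}` is itself `A_{μp₁} ∘ S`.
  rw [← A_mul_comp_S_eq_C₂ u v hμ0 hμ hν0 hν (w := -w) (by linear_combination -hw),
    comp_S_comp_S, mul_comm]

end

end DoubleEta

open DoubleEta
theorem mainTheorem5 (p₁ p₂ : ℕ) [Fact p₁.Prime] [Fact p₂.Prime] :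
    -- (i)
    (comp (A p₁ p₂ 0) ModularGroup.S = B p₁ p₂ ∧
      comp (B p₁ p₂) ModularGroup.S = A p₁ p₂ 0) ∧
    -- (ii)
    ((p₁ ≠ p₂ → p₁ ≠ 2) →
      ∀ ν ω v₁₂ : ℤ, 0 < ν → ν < p₁ * p₂ → IsCoprime ν ((p₁ : ℤ) * p₂) →
        1 = -ω * ν + v₁₂ * (p₁ * p₂) →
        comp (A p₁ p₂ ν) ModularGroup.S =
          fun z => phi p₁ p₂ ^ theta₃ p₁ p₂ ν ω v₁₂ * A p₁ p₂ ω z) ∧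
    (p₁ ≠ p₂ → ∀ u v : ℤ, u * p₁ + v * p₂ = 1 →
      -- (iii)
      (∀ ρ ϖ w : ℤ, 0 < p₁ * ρ → p₁ * ρ < p₁ * p₂ → 0 < ϖ → ϖ < p₂ →
        1 = -ϖ * (p₁ * ρ) + w * p₂ →
        comp (A p₁ p₂ (p₁ * ρ)) ModularGroup.S =
          fun z => phi p₁ p₂ ^ theta₄ p₁ p₂ u v ρ ϖ w * C₂ p₁ p₂ u v ϖ z) ∧
      -- (iv)
      (∀ ν μ : ℤ, 0 < ν → ν < p₂ → 0 < μ → μ < p₂ → μ * (ν * p₁) ≡ -1 [ZMOD p₂] →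
        comp (C₂ p₁ p₂ u v ν) ModularGroup.S = A p₁ p₂ (μ * p₁)) ∧
      -- (v)
      (comp (C₂ p₁ p₂ u v 0) ModularGroup.S =
        fun z => phi p₁ p₂ ^ theta₅ p₁ p₂ u v * C₁ p₁ p₂ u v 0 z)) := by
  have h₁ : 0 < p₁ := (Fact.out : p₁.Prime).pos
  have h₂ : 0 < p₂ := (Fact.out : p₂.Prime).pos
  have hi := A_zero_comp_S h₁ h₂
  refine ⟨⟨hi, ?_⟩, ?_, ?_⟩
  · rw [← hi, comp_S_comp_S]
  · intro hp ν ω v _ _ _ h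
    by_cases hp₂ : p₂ = 2
    · subst hp₂
      exact A_comp_S_of_two h₁ h
    · have hp₁ : p₁ ≠ 2 := by
        rintro rfl
        exact hp (Ne.symm hp₂) rfl
      exact A_comp_S_of_odd (odd_of_prime_ne_two hp₁) (odd_of_prime_ne_two hp₂) h
  · intro hne u v huv
    refine ⟨fun ρ ϖ w h0 hlt hϖ0 hϖ h ↦ ?_, fun ν μ hν0 hν hμ0 hμ h ↦
      C₂_comp_S_eq_A u v hν0 hν hμ0 hμ h, C₂_zero_comp_S_eq_C₁ hne huv⟩
    have hp : (0 : ℤ) < p₁ := by exact_mod_cast h₁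
    have hρ0 := pos_of_mul_pos_right h0 hp.le
    have hρ := lt_of_mul_lt_mul_left hlt hp.le
    rw [A_mul_comp_S_eq_C₂ u v hρ0 hρ hϖ0 hϖ h, theta₄_eq_zero u v hρ0 hρ hϖ0 hϖ h]
    simp
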